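/- A simple game is a pair $\Gamma=(N,\mathcal W)$ with $N=\{1,\dots,n\}$ and $\mathcal W$ a family of subsets of $N$ (the winning coalitions) such that $N\in\mathcal W$, $\emptyset\notin\mathcal W$, and $S\in\mathcal W$, $S\subseteq T\subseteq N$ imply $T\in\mathcal W$. The family $\mathcal L$ of losing coalitions consists of the subsets of $N$ not in $\mathcal W$. A $j$-trade application of $\Gamma$ is a tuple $(S_1,\dots,S_{2j})$ of (not necessarily distinct) coalitions for which there is $I\subseteq\{1,\dots,2j\}$ with $|I|=j$, such that $S_i\in\mathcal W$ if and only if $i\in I$, and such that every player $p\in N$ satisfies $|\{i\in I: p\in S_i\}|=|\{i\in\{1,\dots,2j\}\setminus I: p\in S_i\}|$. The game is $j$-trade if it admits a $j$-trade application. Theorem. Let $j\in\mathbb N$ be fixed. Consider simple games $\Gamma$ given by $(N,\mathcal L)$, that is, by the set of players and an explicit list of all losing coalitions (each written as its characteristic vector of length $n$). There is a Turing machine that, given $(N,\mathcal L)$, decides in time polynomial in the length of the input whether $\Gamma$ is $j$-trade. Furthermore, there is a Turing machine that, given $(N,\mathcal L)$, outputs in time polynomial in the length of the input a $j$-trade application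 of $\Gamma$ if $\Gamma$ is $j$-trade, and reports that there is none otherwise. -/

import Mathlib

/-- A simple game with player set `N = Fin n`. The losing coalitions are the subsets of `N`
that do not belong to `winning`. -/
structure SimpleGame (n : ℕ) where
  /-- the family of winning coalitions -/
  winning : Set (Finset (Fin n))
  univ_mem : Finset.univ ∈ winning
  empty_notMem : ∅ ∉ winning
  mono : ∀ S T : Finset (Fin n), S ∈ winning → S ⊆ T → T ∈ winning

/-- `(S_1, …, S_{2j})` is a `j`-trade application: for some set `I` of `j` indices, the winning
`S_i` are exactly those with `i ∈ I`, and every player occurs equally often among the `S_i` with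
`i ∈ I` and among the `S_i` with `i ∉ I`. The coalitions `S_i` need not be distinct. -/
def SimpleGame.IsTradeApplication {n : ℕ} (G : SimpleGame n) (j : ℕ)
    (S : Fin (2 * j) → Finset (Fin n)) : Prop :=
  ∃ I : Finset (Fin (2 * j)), I.card = j ∧
    (∀ i, S i ∈ G.winning ↔ i ∈ I) ∧
    ∀ p : Fin n, {i ∈ I | p ∈ S i}.card = {i ∈ Iᶜ | p ∈ S i}.card

/-- A simple game is `j`-trade if it admits a `j`-trade application. -/
def SimpleGame.IsTrade {n : ℕ} (G : SimpleGame n) (j : ℕ) : Prop :=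
  ∃ S : Fin (2 * j) → Finset (Fin n), G.IsTradeApplication j S

/-- A simple game presented by `(N, 𝓛)`: the players `N = Fin n` together with an explicit
listing, in any order, of the losing coalitions. -/
structure LosingForm where
  /-- the number of players -/
  n : ℕ
  /-- the game that is presented -/
  game : SimpleGame n
  /-- the list of its losing coalitions -/
  losing : List (Finset (Fin n))
  mem_losing : ∀ S : Finset (Fin n), S ∈ losing ↔ S ∉ game.winning

/-- A coalition is written as its characteristic vector, of length `n`, followed by the
separator `none`. The alphabet is `Option Bool = {some false, some true, none}`. -/
def encodeCoalition {n : ℕ} (S : Finset (Fin n)) : List (Option Bool) :=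
  (List.finRange n).map (fun p => some (decide (p ∈ S))) ++ [none]

/-- A list of coalitions is written by writing its members one after the other. -/
def encodeCoalitions {n : ℕ} (l : List (Finset (Fin n))) : List (Option Bool) :=
  l.flatMap encodeCoalition

/-- The input word for `(N, 𝓛)`: first `N` (as a coalition), then the listed losing coalitions.
It does not contain any other information on the game. -/
def encodeLosingForm (x : LosingForm) : List (Option Bool) :=
  encodeCoalitions (Finset.univ :: x.losing)

/-- The output word of the search problem: the letter `0` for the answer that there is no
`j`-trade application, or the letter `1` followed by the coalitions `S_1, …, S_{2j}`. -/
def encodeAnswer {n j : ℕ} : Option (Fin (2 * j) → Finset (Fin n)) → List (Option Bool)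
  | none => [some false]
  | some S => some true :: encodeCoalitions (List.ofFn S)

/-! Every winning coalition needed in a trade can be described by two listed losing coalitions. In a
trade application each player of a winning member also occurs in some losing member, so by
monotonicity no winning member contains a winning singleton. A minimal winning coalition `w` inside
such a member then has two distinct players `p`, `q`; by minimality `w.erase p` and `w.erase q` are
losing, and their union is `w` (`exists_union_mem_winning`). So a trade yields `j` triples `(L, A,
B)` of losing coalitions such that each `A ∪ B` is winning and every player occurs in at most as
many unions as sets `L` (`IsTrade.exists_losing`).

Conversely, the inequality can be turned into equality by adding players to the unions, one player
at a time; supersets of winning coalitions stay winning (`isTradeApplication_tradeOf`). Hence being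
`j`-trade amounts to the existence of a suitable `3 * j`-tuple from the list, and for fixed `j`
there are polynomially many such tuples.

Each test is local to a player. A union is winning exactly when it differs from every listed
coalition, which one extra, universally quantified head checks; the counts are compared column by
column. A finite automaton therefore suffices, and even the enlarged coalitions can be written
letter by letter. `BlockSearch` isolates this pattern. Its machine keeps one copy of the list per
head, split into two stacks at the head position, and runs through the tuples like an odometer
(`search_outcome`). -/

/-- A search over all tuples of `heads + 1` blocks of a list of blocks. A tuple is scanned column by
column by a finite automaton. The last head is universally quantified, the others existentially.
For the first tuple of blocks that is found, `rounds` many blocks are written, each computed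
letter by letter from the columns of the tuple. -/
structure BlockSearch where
  /-- number of existentially quantified heads -/
  heads : ℕ
  /-- states of the scanning automaton -/
  Q : Type
  [fintypeQ : Fintype Q]
  /-- initial state of the scanning automaton -/
  start : Q
  /-- transition function of the scanning automaton -/
  trans : Q → (Fin (heads + 1) → Option Bool) → Q
  /-- accepting states of the scanning automaton -/
  accept : Q → Bool
  /-- output alphabet -/
  O : Type
  [fintypeO : Fintype O]
  /-- first letter of the output when the search is successful -/
  yes : O
  /-- output when the search is not successful -/
  no : O
  /-- number of blocks that are written when the search is successful -/
  rounds : ℕ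
  /-- the letter written in a given round for a given column -/
  write : Fin rounds → (Fin (heads + 1) → Option Bool) → O

/-! ### The stack machine that carries out a block search -/

namespace BlockSearch

attribute [instance] fintypeQ fintypeO

open Turing TM2.Stmt

/-- The stacks of the machine: every head has a stack on either side. -/
inductive Stk (D : ℕ)
  | inp
  | out
  | buf
  | lft (i : Fin (D + 1))
  | rgt (i : Fin (D + 1))
  deriving DecidableEq, Fintype

/-- What is to be done after the scan of a tuple of blocks. -/
inductive Mode (R : ℕ)
  | init
  | check
  | emit (r : Fin R)
  deriving Fintype

/-- The labels of the machine. -/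
inductive Label (D R : ℕ)
  | drop
  | load
  | fwd (m : Mode R)
  | back (m : Mode R)
  | sweep
  | decide
  | adv (d : Fin (D + 1))
  | rew (d : Fin (D + 1))
  | exit (d : Fin (D + 1))
  | found (r : Fin (R + 1))
  | clean
  deriving Fintype

/-- The internal states of the machine: the letters read last, the state of the scanning
automaton, and a flag. -/
structure State (D : ℕ) (Q : Type) where
  col : Fin (D + 1) → Option (Option Bool)
  q : Q
  ok : Bool
  deriving Fintype

/-- The letter read last by a head. -/
def State.letter {D : ℕ} {Q : Type} (s : State D Q) (i : Fin (D + 1)) : Option Bool :=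
  (s.col i).getD none

variable (P : BlockSearch)

/-- The alphabets of the stacks. -/
abbrev Alphabet : Stk P.heads → Type
  | .inp => Option Bool
  | .out => P.O
  | .buf => Fin (P.heads + 1) → Option Bool
  | .lft _ => Option Bool
  | .rgt _ => Option Bool

instance : ∀ k, Fintype (P.Alphabet k)
  | .inp => inferInstanceAs (Fintype (Option Bool))
  | .out => P.fintypeO
  | .buf => inferInstanceAs (Fintype (Fin (P.heads + 1) → Option Bool))
  | .lft _ => inferInstanceAs (Fintype (Option Bool))
  | .rgt _ => inferInstanceAs (Fintype (Option Bool))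

/-- The statements of the machine. -/
abbrev Code : Type := TM2.Stmt P.Alphabet (Label P.heads P.rounds) (State P.heads P.Q)

/-- Pop a letter from the right stack of each of the given heads. -/
def popAll (l : List (Fin (P.heads + 1))) (q : P.Code) : P.Code :=
  l.foldr (fun i q => pop (.rgt i) (fun s x => { s with col := Function.update s.col i x }) q) q

/-- Push the letters read last to the right stacks of the given heads. -/
def pushAll (l : List (Fin (P.heads + 1))) (q : P.Code) : P.Code :=
  l.foldr (fun i q => push (.rgt i) (fun s => s.letter i) q) q

/-- Pop a letter from each of the given stacks, and lower the flag if one of them is not empty. -/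
def popFlag (l : List (Stk P.heads)) (q : P.Code) : P.Code :=
  l.foldr (fun k q => pop k (fun s x => { s with ok := s.ok && x.isNone }) q) q

/-- Write a letter if the mode says so. -/
def writeLetter : Mode P.rounds → P.Code → P.Code
  | .init, q => q
  | .check, q => q
  | .emit r, q => push .out (fun s => P.write r s.letter) q

/-- The label at which the machine goes on after the scan of a tuple. -/
def after : Mode P.rounds → Label P.heads P.rounds
  | .init => .sweep
  | .check => .decide
  | .emit r => .found r.castSucc

/-- The initial internal state. -/
def initState : State P.heads P.Q := ⟨fun _ => none, P.start, true⟩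

/-- The stacks that have to be emptied at the end. -/
noncomputable def workStacks : List (Stk P.heads) := (Finset.univ.erase Stk.out).toList

/-- The program of the machine. -/
noncomputable def code : Label P.heads P.rounds → P.Code
  | .drop =>
    pop .inp (fun s x => { s with col := fun _ => x }) <|
    branch (fun s => s.col 0 == some none) (goto fun _ => .load) (goto fun _ => .drop)
  -- Each letter becomes a constant column, so the backward pass that restores scanned blocks also
  -- deals out a copy of the list to every head.
  | .load =>
    pop .inp (fun s x => { s with col := fun _ => x }) <|
    branch (fun s => s.col 0 == none) (goto fun _ => .back .init) <|
    push .buf (fun s => s.letter) (goto fun _ => .load)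
  -- Testing head 0 for the separator is enough, because all blocks have the same length.
  | .fwd m =>
    P.popAll (List.finRange _) <|
    push .buf (fun s => s.letter) <|
    TM2.Stmt.load (fun s => { s with q := P.trans s.q s.letter }) <|
    branch (fun s => s.letter 0 == none) (goto fun _ => .back m) (goto fun _ => .fwd m)
  | .back m =>
    pop .buf (fun s x => { s with col := fun i => x.map (fun c => c i) }) <|
    branch (fun s => s.col 0 == none) (goto fun _ => P.after m) <|
    P.pushAll (List.finRange _) <|
    P.writeLetter m <|
    goto fun _ => .back m
  | .sweep => TM2.Stmt.load (fun s => { s with q := P.start }) (goto fun _ => .fwd .check)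
  | .decide =>
    branch (fun s => P.accept s.q) (goto fun _ => .adv (Fin.last _)) <|
    TM2.Stmt.load (fun s => { s with ok := false }) (goto fun _ => .rew (Fin.last _))
  | .adv d =>
    pop (.rgt d) (fun s x => { s with col := fun _ => x }) <|
    push (.lft d) (fun s => s.letter d) <|
    branch (fun s => s.letter d == none)
      -- An empty right stack means that the head has passed the last block. For the universal head
      -- this is success, hence the raised flag.
      (peek (.rgt d) (fun s x => { s with col := fun _ => x }) <|
        branch (fun s => s.col d == none)
          (TM2.Stmt.load (fun s => { s with ok := true }) (goto fun _ => .rew d))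
          (goto fun _ => .sweep))
      (goto fun _ => .adv d)
  | .rew d =>
    pop (.lft d) (fun s x => { s with col := fun _ => x }) <|
    branch (fun s => s.col d == none)
      -- A rewind of the last head follows either full acceptance or a rejection, and the flag tells
      -- which; for any other head it means exhaustion.
      (branch (fun s => (d == Fin.last _) && s.ok)
        (goto fun _ => .found (Fin.last _)) (goto fun _ => .exit d)) <|
    push (.rgt d) (fun s => s.letter d) (goto fun _ => .rew d)
  -- The carry of the odometer: an exhausted level advances the head below it, and level 0 ends the
  -- search.
  | .exit d => Fin.cases (push .out (fun _ => P.no) (goto fun _ => .clean))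
      (fun e => goto fun _ => .adv e.castSucc) d
  -- The output is a stack, so the rounds run downwards and the leading letter is pushed last.
  | .found r => Fin.cases (push .out (fun _ => P.yes) (goto fun _ => .clean))
      (fun e => goto fun _ => .fwd (.emit e)) r
  | .clean =>
    TM2.Stmt.load (fun s => { s with ok := true }) <|
    P.popFlag P.workStacks <|
    branch (fun s => s.ok) (TM2.Stmt.load (fun _ => P.initState) halt) (goto fun _ => .clean)

/-- The Turing machine. -/
noncomputable def machine : FinTM2 where
  K := Stk P.heads
  k₀ := .inp
  k₁ := .out
  Γ := P.Alphabet
  Λ := Label P.heads P.rounds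
  main := .drop
  σ := State P.heads P.Q
  initialState := P.initState
  m := P.code

/-- The configurations of the machine. -/
abbrev Conf : Type := TM2.Cfg P.Alphabet (Label P.heads P.rounds) (State P.heads P.Q)

/-- The contents of the stacks. -/
def tape (inp : List (Option Bool)) (out : List P.O)
    (buf : List (Fin (P.heads + 1) → Option Bool))
    (lft rgt : Fin (P.heads + 1) → List (Option Bool)) : ∀ k, List (P.Alphabet k)
  | .inp => inp
  | .out => out
  | .buf => buf
  | .lft i => lft i
  | .rgt i => rgt i

section tape

variable {P} (inp : List (Option Bool)) (out : List P.O)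
    (buf : List (Fin (P.heads + 1) → Option Bool))
    (lft rgt : Fin (P.heads + 1) → List (Option Bool))

@[simp] theorem tape_inp : P.tape inp out buf lft rgt .inp = inp := rfl
@[simp] theorem tape_out : P.tape inp out buf lft rgt .out = out := rfl
@[simp] theorem tape_buf : P.tape inp out buf lft rgt .buf = buf := rfl
@[simp] theorem tape_lft (i) : P.tape inp out buf lft rgt (.lft i) = lft i := rfl
@[simp] theorem tape_rgt (i) : P.tape inp out buf lft rgt (.rgt i) = rgt i := rfl

@[simp] theorem update_tape_inp (x : List (Option Bool)) :
    Function.update (P.tape inp out buf lft rgt) .inp x = P.tape x out buf lft rgt := by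
  funext k; cases k <;> simp [Function.update]

@[simp] theorem update_tape_out (x : List P.O) :
    Function.update (P.tape inp out buf lft rgt) .out x = P.tape inp x buf lft rgt := by
  funext k; cases k <;> simp [Function.update]

@[simp] theorem update_tape_buf (x : List (Fin (P.heads + 1) → Option Bool)) :
    Function.update (P.tape inp out buf lft rgt) .buf x = P.tape inp out x lft rgt := by
  funext k; cases k <;> simp [Function.update]

@[simp] theorem update_tape_lft (i) (x : List (Option Bool)) :
    Function.update (P.tape inp out buf lft rgt) (.lft i) x =
      P.tape inp out buf (Function.update lft i x) rgt := by
  funext k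
  cases k with
  | lft j =>
    by_cases h : j = i
    · subst h; simp
    · rw [Function.update_of_ne (by simpa using h), tape_lft, tape_lft,
        Function.update_of_ne h]
  | _ => rw [Function.update_of_ne (by simp)]; rfl

@[simp] theorem update_tape_rgt (i) (x : List (Option Bool)) :
    Function.update (P.tape inp out buf lft rgt) (.rgt i) x =
      P.tape inp out buf lft (Function.update rgt i x) := by
  funext k
  cases k with
  | rgt j =>
    by_cases h : j = i
    · subst h; simp
    · rw [Function.update_of_ne (by simpa using h), tape_rgt, tape_rgt,
        Function.update_of_ne h]
  | _ => rw [Function.update_of_ne (by simp)]; rfl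

end tape

/-! ### Runs of bounded length -/

/-- `P.Within a b t`: the machine gets from `a` to `b` in at most `t` steps. -/
def Within (a b : P.Conf) (t : ℕ) : Prop :=
  ∃ k ≤ t, (flip bind (TM2.step P.code))^[k] (some a) = some b

variable {P}

theorem Within.refl (a : P.Conf) : P.Within a a 0 := ⟨0, le_rfl, rfl⟩

theorem Within.trans {a b c : P.Conf} {t u : ℕ} (h : P.Within a b t) (h' : P.Within b c u) :
    P.Within a c (t + u) := by
  obtain ⟨k, hk, e⟩ := h
  obtain ⟨k', hk', e'⟩ := h'
  exact ⟨k' + k, by omega, by rw [Function.iterate_add_apply, e, e']⟩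

theorem Within.mono {a b : P.Conf} {t u : ℕ} (h : P.Within a b t) (htu : t ≤ u) :
    P.Within a b u := by
  obtain ⟨k, hk, e⟩ := h
  exact ⟨k, by omega, e⟩

theorem Within.step {l : Label P.heads P.rounds} {s : State P.heads P.Q}
    {S : ∀ k, List (P.Alphabet k)} {b : P.Conf}
    (h : TM2.stepAux (P.code l) s S = b) : P.Within ⟨some l, s, S⟩ b 1 :=
  ⟨1, le_rfl, by rw [← h]; rfl⟩

theorem Within.head {l : Label P.heads P.rounds} {s : State P.heads P.Q}
    {S : ∀ k, List (P.Alphabet k)} {b : P.Conf} {t : ℕ}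
    (h : P.Within (TM2.stepAux (P.code l) s S) b t) : P.Within ⟨some l, s, S⟩ b (t + 1) := by
  rw [add_comm]
  exact (Within.step rfl).trans h

theorem stepAux_popAll (inp : List (Option Bool)) (out : List P.O)
    (buf : List (Fin (P.heads + 1) → Option Bool))
    (lft rgt : Fin (P.heads + 1) → List (Option Bool)) (q : P.Code) (s : State P.heads P.Q)
    (l : List (Fin (P.heads + 1))) (hl : l.Nodup) :
    TM2.stepAux (P.popAll l q) s (P.tape inp out buf lft rgt) =
      TM2.stepAux q { s with col := fun i => if i ∈ l then (rgt i).head? else s.col i }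
        (P.tape inp out buf lft fun i => if i ∈ l then (rgt i).tail else rgt i) := by
  induction l generalizing s rgt with
  | nil => simp [popAll]
  | cons a l ih =>
    rw [List.nodup_cons] at hl
    rw [popAll, List.foldr_cons, TM2.stepAux, update_tape_rgt]
    refine (ih _ _ hl.2).trans ?_
    congr 2
    · funext i
      by_cases h : i = a
      · subst h; simp [hl.1]
      · simp [h]
    · funext i
      by_cases h : i = a
      · subst h; simp [hl.1]
      · simp [h]

theorem stepAux_pushAll (inp : List (Option Bool)) (out : List P.O)
    (buf : List (Fin (P.heads + 1) → Option Bool))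
    (lft rgt : Fin (P.heads + 1) → List (Option Bool)) (q : P.Code) (s : State P.heads P.Q)
    (l : List (Fin (P.heads + 1))) (hl : l.Nodup) :
    TM2.stepAux (P.pushAll l q) s (P.tape inp out buf lft rgt) =
      TM2.stepAux q s
        (P.tape inp out buf lft fun i => if i ∈ l then s.letter i :: rgt i else rgt i) := by
  induction l generalizing rgt with
  | nil => simp [pushAll]
  | cons a l ih =>
    rw [List.nodup_cons] at hl
    rw [pushAll, List.foldr_cons, TM2.stepAux, update_tape_rgt]
    refine (ih _ hl.2).trans ?_
    congr 2
    funext i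
    by_cases h : i = a
    · subst h; simp [hl.1]
    · simp [h]

theorem stepAux_popFlag (S : ∀ k, List (P.Alphabet k)) (q : P.Code) (s : State P.heads P.Q)
    (l : List (Stk P.heads)) (hl : l.Nodup) :
    TM2.stepAux (P.popFlag l q) s S =
      TM2.stepAux q { s with ok := s.ok && l.all fun k => (S k).isEmpty }
        (fun k => if k ∈ l then (S k).tail else S k) := by
  induction l generalizing s S with
  | nil => simp [popFlag]
  | cons a l ih =>
    rw [List.nodup_cons] at hl
    rw [popFlag, List.foldr_cons, TM2.stepAux]
    refine (ih _ _ hl.2).trans ?_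
    congr 2
    · simp only [List.all_cons, Bool.and_assoc]
      congr 2
      · cases S a <;> rfl
      · rw [Bool.eq_iff_iff, List.all_eq_true, List.all_eq_true]
        refine forall₂_congr fun k hk => ?_
        rw [Function.update_of_ne (by rintro rfl; exact hl.1 hk)]
    · funext i
      by_cases h : i = a
      · subst h; simp [hl.1]
      · simp [h]

/-- A configuration in terms of the contents of the stacks. -/
abbrev conf (P : BlockSearch) (l : Label P.heads P.rounds) (s : State P.heads P.Q)
    (inp : List (Option Bool)) (out : List P.O) (buf : List (Fin (P.heads + 1) → Option Bool))
    (lft rgt : Fin (P.heads + 1) → List (Option Bool)) : P.Conf :=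
  ⟨some l, s, P.tape inp out buf lft rgt⟩

/-! ### Scanning, advancing, rewinding, loading and cleaning -/

section subroutines

variable (s : State P.heads P.Q) (inp : List (Option Bool)) (out : List P.O)
    (buf : List (Fin (P.heads + 1) → Option Bool))
    (lft rgt : Fin (P.heads + 1) → List (Option Bool))

theorem step_fwd (m : Mode P.rounds) (c : Fin (P.heads + 1) → Option Bool) :
    TM2.stepAux (P.code (.fwd m)) s (P.tape inp out buf lft fun i => c i :: rgt i) =
      P.conf (if c 0 = none then .back m else .fwd m)
        ⟨fun i => some (c i), P.trans s.q c, s.ok⟩ inp out (c :: buf) lft rgt := by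
  rw [code, stepAux_popAll _ _ _ _ _ _ _ _ (List.nodup_finRange _)]
  have h : (⟨fun i => some (c i), s.q, s.ok⟩ : State P.heads P.Q).letter = c := rfl
  have h' : (⟨fun i => some (c i), P.trans s.q c, s.ok⟩ : State P.heads P.Q).letter = c := rfl
  simp only [List.mem_finRange, if_true, List.head?_cons, List.tail_cons, TM2.stepAux,
    tape_buf, update_tape_buf, h, h', conf]
  cases hc : c 0 <;> simp

theorem within_fwd (m : Mode P.rounds) (cs : List (Fin (P.heads + 1) → Option Bool))
    (e : Fin (P.heads + 1) → Option Bool) (hcs : ∀ c ∈ cs, c 0 ≠ none) (he : e 0 = none) :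
    ∃ s' : State P.heads P.Q, s'.q = (cs ++ [e]).foldl P.trans s.q ∧ s'.ok = s.ok ∧
      P.Within (P.conf (.fwd m) s inp out buf lft fun i => (cs ++ [e]).map (· i) ++ rgt i)
        (P.conf (.back m) s' inp out ((cs ++ [e]).reverse ++ buf) lft rgt) (cs.length + 1) := by
  induction cs generalizing s buf with
  | nil =>
    refine ⟨⟨fun i => some (e i), P.trans s.q e, s.ok⟩, rfl, rfl, Within.head ?_⟩
    simp only [List.nil_append, List.map_cons, List.map_nil, List.cons_append]
    rw [step_fwd, if_pos he]
    exact Within.refl _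
  | cons c cs ih =>
    obtain ⟨s', hq, hok, h⟩ := ih ⟨fun i => some (c i), P.trans s.q c, s.ok⟩ (c :: buf)
      fun c hc => hcs c (List.mem_cons_of_mem _ hc)
    refine ⟨s', hq, hok, Within.head ?_⟩
    simp only [List.cons_append, List.map_cons]
    rw [step_fwd, if_neg (hcs c List.mem_cons_self)]
    simpa using h

/-- The letters written by the machine when it goes back over a list of columns. -/
def written (m : Mode P.rounds) (cs : List (Fin (P.heads + 1) → Option Bool)) : List P.O :=
  match m with
  | .init => []
  | .check => []
  | .emit r => cs.map (P.write r)

theorem written_append (m : Mode P.rounds) (cs cs' : List (Fin (P.heads + 1) → Option Bool)) :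
    P.written m (cs ++ cs') = P.written m cs ++ P.written m cs' := by
  cases m <;> simp [written]

theorem stepAux_writeLetter (m : Mode P.rounds) (q : P.Code) :
    TM2.stepAux (P.writeLetter m q) s (P.tape inp out buf lft rgt) =
      TM2.stepAux q s (P.tape inp (P.written m [s.letter] ++ out) buf lft rgt) := by
  cases m <;> simp [written, writeLetter]

theorem step_back (m : Mode P.rounds) (c : Fin (P.heads + 1) → Option Bool) :
    TM2.stepAux (P.code (.back m)) s (P.tape inp out (c :: buf) lft rgt) =
      P.conf (.back m) ⟨fun i => some (c i), s.q, s.ok⟩ inp (P.written m [c] ++ out) buf lft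
        fun i => c i :: rgt i := by
  have h : (⟨fun i => some (c i), s.q, s.ok⟩ : State P.heads P.Q).letter = c := rfl
  simp [code, stepAux_pushAll _ _ _ _ _ _ _ _ (List.nodup_finRange _), stepAux_writeLetter, h]

theorem step_back_nil (m : Mode P.rounds) :
    TM2.stepAux (P.code (.back m)) s (P.tape inp out [] lft rgt) =
      P.conf (P.after m) ⟨fun _ => none, s.q, s.ok⟩ inp out [] lft rgt := by
  simp [code]

/-- The buffer is popped in reverse column order, so pushing restores the right stacks and puts the
written letters in column order. -/
theorem within_back (m : Mode P.rounds) (cs : List (Fin (P.heads + 1) → Option Bool)) :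
    ∃ s' : State P.heads P.Q, s'.q = s.q ∧ s'.ok = s.ok ∧
      P.Within (P.conf (.back m) s inp out cs lft rgt)
        (P.conf (P.after m) s' inp (P.written m cs.reverse ++ out) [] lft
          fun i => cs.reverse.map (· i) ++ rgt i) (cs.length + 1) := by
  induction cs generalizing s out rgt with
  | nil =>
    refine ⟨⟨fun _ => none, s.q, s.ok⟩, rfl, rfl, Within.head ?_⟩
    have : P.written m [].reverse = [] := by cases m <;> rfl
    rw [step_back_nil, this]
    exact Within.refl _
  | cons c cs ih =>
    obtain ⟨s', hq, hok, h⟩ := ih ⟨fun i => some (c i), s.q, s.ok⟩ (P.written m [c] ++ out)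
      fun i => c i :: rgt i
    refine ⟨s', hq, hok, Within.head ?_⟩
    rw [step_back]
    simpa [written_append] using h

theorem step_adv (d : Fin (P.heads + 1)) (x : Option Bool) (r : List (Option Bool))
    (h : rgt d = x :: r) :
    ∃ s' : State P.heads P.Q, (s'.ok = if x = none ∧ r = [] then true else s.ok) ∧
      TM2.stepAux (P.code (.adv d)) s (P.tape inp out buf lft rgt) =
      P.conf (if x = none then if r = [] then .rew d else .sweep else .adv d) s'
        inp out buf (Function.update lft d (x :: lft d)) (Function.update rgt d r) := by
  refine ⟨⟨fun _ => if x = none then r.head? else some x, s.q,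
    if x = none ∧ r = [] then true else s.ok⟩, rfl, ?_⟩
  cases x <;> cases r <;> simp [code, h, State.letter]

theorem within_adv (d : Fin (P.heads + 1)) (l : List (Option Bool)) (hl : none ∉ l)
    (r : List (Option Bool)) (h : rgt d = l ++ none :: r) :
    ∃ s' : State P.heads P.Q, (r = [] → s'.ok = true) ∧
      P.Within (P.conf (.adv d) s inp out buf lft rgt)
        (P.conf (if r = [] then .rew d else .sweep) s' inp out buf
          (Function.update lft d (none :: l.reverse ++ lft d)) (Function.update rgt d r))
        (l.length + 1) := by
  induction l generalizing s lft rgt with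
  | nil =>
    obtain ⟨s', hs, h'⟩ := step_adv s inp out buf lft rgt d none r (by simpa using h)
    refine ⟨s', fun hr => by simp [hs, hr], Within.head ?_⟩
    rw [h', if_pos rfl]
    exact Within.refl _
  | cons x l ih =>
    rw [List.mem_cons, not_or] at hl
    obtain ⟨s', hs, h'⟩ := step_adv s inp out buf lft rgt d x _ (by simpa using h)
    obtain ⟨s'', hs', h''⟩ := ih s' (Function.update lft d (x :: lft d))
      (Function.update rgt d (l ++ none :: r)) hl.2 (by simp)
    refine ⟨s'', hs', Within.head ?_⟩
    rw [h', if_neg (Ne.symm hl.1)]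
    simpa using h''

theorem step_rew (d : Fin (P.heads + 1)) (x : Option Bool) (l : List (Option Bool))
    (h : lft d = x :: l) :
    TM2.stepAux (P.code (.rew d)) s (P.tape inp out buf lft rgt) =
      P.conf (.rew d) ⟨fun _ => some x, s.q, s.ok⟩ inp out buf (Function.update lft d l)
        (Function.update rgt d (x :: rgt d)) := by
  simp [code, h, State.letter]

theorem step_rew_nil (d : Fin (P.heads + 1)) (h : lft d = []) :
    TM2.stepAux (P.code (.rew d)) s (P.tape inp out buf lft rgt) =
      P.conf (if d = Fin.last _ ∧ s.ok then .found (Fin.last _) else .exit d)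
        ⟨fun _ => none, s.q, s.ok⟩ inp out buf lft rgt := by
  have hu : Function.update lft d [] = lft := by rw [← h, Function.update_eq_self]
  by_cases hd : d = Fin.last _
  · subst hd; cases hs : s.ok <;> simp [code, h, hs, hu]
  · have hd' : (d == Fin.last _) = false := by simpa using hd
    simp [code, h, hd, hd', hu]

theorem within_rew (d : Fin (P.heads + 1)) :
    ∃ s' : State P.heads P.Q,
      P.Within (P.conf (.rew d) s inp out buf lft rgt)
        (P.conf (if d = Fin.last _ ∧ s.ok then .found (Fin.last _) else .exit d) s' inp out buf
          (Function.update lft d []) (Function.update rgt d ((lft d).reverse ++ rgt d)))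
        ((lft d).length + 1) := by
  induction hl : lft d generalizing s lft rgt with
  | nil =>
    refine ⟨⟨fun _ => none, s.q, s.ok⟩, Within.head ?_⟩
    rw [step_rew_nil _ _ _ _ _ _ _ hl]
    have : Function.update lft d [] = lft := by rw [← hl, Function.update_eq_self]
    rw [this, List.reverse_nil, List.nil_append, Function.update_eq_self]
    exact Within.refl _
  | cons x l ih =>
    obtain ⟨s', h⟩ := ih ⟨fun _ => some x, s.q, s.ok⟩ (Function.update lft d l)
      (Function.update rgt d (x :: rgt d)) (by simp)
    refine ⟨s', Within.head ?_⟩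
    rw [step_rew _ _ _ _ _ _ _ _ _ hl]
    simpa using h

theorem within_drop (l : List (Option Bool)) (hl : none ∉ l) :
    ∃ s' : State P.heads P.Q,
      P.Within (P.conf .drop s (l ++ none :: inp) out buf lft rgt)
        (P.conf .load s' inp out buf lft rgt) (l.length + 1) := by
  induction l generalizing s with
  | nil =>
    refine ⟨⟨fun _ => some none, s.q, s.ok⟩, Within.head ?_⟩
    simpa [code] using Within.refl _
  | cons x l ih =>
    rw [List.mem_cons, not_or] at hl
    obtain ⟨s', h⟩ := ih ⟨fun _ => some x, s.q, s.ok⟩ hl.2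
    refine ⟨s', Within.head ?_⟩
    obtain ⟨y, rfl⟩ := Option.ne_none_iff_exists'.1 (Ne.symm hl.1)
    simpa [code] using h

theorem within_load :
    ∃ s' : State P.heads P.Q,
      P.Within (P.conf .load s inp out buf lft rgt)
        (P.conf (.back .init) s' [] out (inp.reverse.map (fun x _ => x) ++ buf) lft rgt)
        (inp.length + 1) := by
  induction inp generalizing s buf with
  | nil =>
    refine ⟨⟨fun _ => none, s.q, s.ok⟩, Within.head ?_⟩
    simpa [code] using Within.refl _
  | cons x l ih =>
    obtain ⟨s', h⟩ := ih ⟨fun _ => some x, s.q, s.ok⟩ ((fun _ => x) :: buf)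
    refine ⟨s', Within.head ?_⟩
    have hs : (⟨fun _ => some x, s.q, s.ok⟩ : State P.heads P.Q).letter = fun _ => x := rfl
    simpa [code, hs] using h

end subroutines

theorem mem_workStacks (k : Stk P.heads) : k ∈ P.workStacks ↔ k ≠ .out := by
  simp [workStacks]

/-- Each pass removes a letter from every nonempty work stack at once, so the longest stack governs
the time. A halting configuration must have only the output left and the initial internal state. -/
theorem within_clean (out : List P.O) (N : ℕ) (s : State P.heads P.Q)
    (S : ∀ k, List (P.Alphabet k)) (hout : S .out = out)
    (hS : ∀ k, k ≠ .out → (S k).length ≤ N) :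
    P.Within ⟨some .clean, s, S⟩
      ⟨none, P.initState, P.tape [] out [] (fun _ => []) (fun _ => [])⟩ (N + 1) := by
  have hstep (s : State P.heads P.Q) (S : ∀ k, List (P.Alphabet k)) :
      TM2.stepAux (P.code .clean) s S =
        if ∀ k, k ≠ .out → S k = [] then ⟨none, P.initState, S⟩ else
          ⟨some .clean, ⟨s.col, s.q, false⟩, fun k => if k ≠ .out then (S k).tail else S k⟩ := by
    simp only [code, TM2.stepAux]
    rw [stepAux_popFlag _ _ _ P.workStacks (Finset.nodup_toList _)]
    simp only [Bool.true_and, TM2.stepAux, mem_workStacks]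
    by_cases h : ∀ k, k ≠ .out → S k = []
    · have h1 : (P.workStacks.all fun k => (S k).isEmpty) = true := by
        simpa [mem_workStacks] using h
      rw [if_pos h, h1, cond_true]
      congr 1
      funext k
      split_ifs with hk
      · rw [h k hk]; rfl
      · rfl
    · have h1 : (P.workStacks.all fun k => (S k).isEmpty) = false := by
        rw [← Bool.not_eq_true]
        simpa [mem_workStacks] using h
      rw [if_neg h, h1, cond_false]
  induction N generalizing s S with
  | zero =>
    have h : ∀ k, k ≠ .out → S k = [] := fun k hk =>
      List.eq_nil_of_length_eq_zero (Nat.le_zero.1 (hS k hk))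
    refine Within.head ?_
    rw [hstep, if_pos h]
    convert Within.refl _ using 2
    funext k
    by_cases hk : k = .out
    · subst hk; exact hout.symm
    · rw [h k hk]; cases k <;> first | rfl | exact absurd rfl hk
  | succ N ih =>
    by_cases h : ∀ k, k ≠ .out → S k = []
    · refine Within.mono (ih s S hout fun k hk => by simp [h k hk]) (by omega)
    · refine Within.head ?_
      rw [hstep, if_neg h]
      refine ih _ _ (by simpa using hout) fun k hk => ?_
      have := hS k hk
      simp only [ne_eq, hk, not_false_eq_true, if_true, List.length_tail]
      omega

/-! ### Lists of coalitions as stack contents -/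

variable {n : ℕ}

theorem encodeCoalition_ne_nil (S : Finset (Fin n)) : encodeCoalition S ≠ [] := by
  simp [encodeCoalition]

theorem length_encodeCoalition (S : Finset (Fin n)) : (encodeCoalition S).length = n + 1 := by
  simp [encodeCoalition]

theorem encodeCoalitions_cons (S : Finset (Fin n)) (l : List (Finset (Fin n))) :
    encodeCoalitions (S :: l) = encodeCoalition S ++ encodeCoalitions l := rfl

theorem encodeCoalitions_append (l l' : List (Finset (Fin n))) :
    encodeCoalitions (l ++ l') = encodeCoalitions l ++ encodeCoalitions l' := by
  simp [encodeCoalitions]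

theorem encodeCoalitions_eq_nil (l : List (Finset (Fin n))) :
    encodeCoalitions l = [] ↔ l = [] := by
  cases l <;> simp [encodeCoalitions, encodeCoalition_ne_nil]

theorem length_encodeCoalitions (l : List (Finset (Fin n))) :
    (encodeCoalitions l).length = l.length * (n + 1) := by
  simp [encodeCoalitions, List.length_flatMap, length_encodeCoalition]

/-- The columns of a tuple of coalitions, followed by the column of the separators. -/
def columns {ι : Type*} (h : ι → Finset (Fin n)) : List (ι → Option Bool) :=
  (List.finRange n).map (fun p i => some (decide (p ∈ h i))) ++ [fun _ => none]

theorem map_columns {ι : Type*} (h : ι → Finset (Fin n)) (i : ι) :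
    (columns h).map (· i) = encodeCoalition (h i) := by
  simp [columns, encodeCoalition]

/-- The tuple of the members of a list at the given positions. -/
def tuple {ι : Type*} (L : List (Finset (Fin n))) (pos : ι → ℕ) : ι → Finset (Fin n) :=
  fun i => L.getD (pos i) ∅

/-- The scanning automaton accepts a tuple. -/
def Accepts (P : BlockSearch) (h : Fin (P.heads + 1) → Finset (Fin n)) : Prop :=
  P.accept ((columns h).foldl P.trans P.start) = true

/-- The tuple at the given positions is accepted for all positions of the last head. -/
def Good (P : BlockSearch) (L : List (Finset (Fin n))) (pos : Fin (P.heads + 1) → ℕ) : Prop :=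
  ∀ c < L.length, P.Accepts (tuple L (Function.update pos (Fin.last _) c))

/-- The configuration in which the heads are at the given positions. -/
abbrev headConf (P : BlockSearch) (l : Label P.heads P.rounds) (s : State P.heads P.Q)
    (L : List (Finset (Fin n))) (out : List P.O) (pos : Fin (P.heads + 1) → ℕ) : P.Conf :=
  P.conf l s [] out [] (fun i => (encodeCoalitions (L.take (pos i))).reverse)
    (fun i => encodeCoalitions (L.drop (pos i)))

/-! ### The nested loops over tuples of blocks -/

section loops

variable (L : List (Finset (Fin n))) (out : List P.O)

theorem encodeCoalitions_drop {k : ℕ} (hk : k < L.length) :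
    encodeCoalitions (L.drop k) =
      encodeCoalition (L.getD k ∅) ++ encodeCoalitions (L.drop (k + 1)) := by
  rw [List.drop_eq_getElem_cons hk, encodeCoalitions_cons, List.getD_eq_getElem _ _ hk]

theorem encodeCoalitions_take {k : ℕ} (hk : k < L.length) :
    encodeCoalitions (L.take (k + 1)) =
      encodeCoalitions (L.take k) ++ encodeCoalition (L.getD k ∅) := by
  rw [List.take_succ_eq_append_getElem hk, encodeCoalitions_append,
    List.getD_eq_getElem _ _ hk, encodeCoalitions_cons]
  simp [encodeCoalitions]

/-- There are `n + 1` columns: `n + 1` steps forward and `n + 2` back, the last one noticing the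
empty buffer. -/
theorem within_scan (m : Mode P.rounds) (s : State P.heads P.Q) (pos : Fin (P.heads + 1) → ℕ)
    (hpos : ∀ i, pos i < L.length) :
    ∃ s' : State P.heads P.Q, s'.q = (columns (tuple L pos)).foldl P.trans s.q ∧ s'.ok = s.ok ∧
      P.Within (P.headConf (.fwd m) s L out pos)
        (P.headConf (P.after m) s' L (P.written m (columns (tuple L pos)) ++ out) pos)
        (2 * n + 3) := by
  have hdrop : (fun i => encodeCoalitions (L.drop (pos i))) = fun i =>
      (columns (tuple L pos)).map (· i) ++ encodeCoalitions (L.drop (pos i + 1)) := by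
    funext i
    rw [map_columns, tuple, encodeCoalitions_drop L (hpos i)]
  obtain ⟨s₁, hq₁, hok₁, h₁⟩ := within_fwd s [] out []
    (fun i => (encodeCoalitions (L.take (pos i))).reverse)
    (fun i => encodeCoalitions (L.drop (pos i + 1))) m
    ((List.finRange n).map fun p i => some (decide (p ∈ tuple L pos i))) (fun _ => none)
    (by simp) rfl
  obtain ⟨s₂, hq₂, hok₂, h₂⟩ := within_back s₁ [] out
    (fun i => (encodeCoalitions (L.take (pos i))).reverse)
    (fun i => encodeCoalitions (L.drop (pos i + 1))) m (columns (tuple L pos)).reverse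
  refine ⟨s₂, hq₂.trans hq₁, hok₂.trans hok₁, ?_⟩
  rw [headConf, headConf, hdrop]
  rw [List.reverse_reverse] at h₂
  rw [List.append_nil] at h₁
  refine (h₁.trans h₂).mono ?_
  simp [columns]
  omega

theorem within_check (s : State P.heads P.Q) (pos : Fin (P.heads + 1) → ℕ)
    (hpos : ∀ i, pos i < L.length) :
    ∃ s' : State P.heads P.Q,
      (P.Accepts (tuple L pos) ∧
        P.Within (P.headConf .sweep s L out pos) (P.headConf (.adv (Fin.last _)) s' L out pos)
          (2 * n + 5)) ∨
      (¬ P.Accepts (tuple L pos) ∧ s'.ok = false ∧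
        P.Within (P.headConf .sweep s L out pos) (P.headConf (.rew (Fin.last _)) s' L out pos)
          (2 * n + 5)) := by
  obtain ⟨s₁, hq, -, h₁⟩ := within_scan L out .check ⟨s.col, P.start, s.ok⟩ pos hpos
  have h₀ : P.Within (P.headConf .sweep s L out pos)
      (P.headConf (.fwd .check) ⟨s.col, P.start, s.ok⟩ L out pos) 1 := Within.step (by simp [code])
  by_cases ha : P.accept s₁.q = true
  · refine ⟨s₁, Or.inl ⟨by rw [Accepts, ← hq, ha], ?_⟩⟩
    have h₂ : P.Within (P.headConf .decide s₁ L out pos)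
      (P.headConf (.adv (Fin.last _)) s₁ L out pos) 1 := Within.step (by simp [code, ha])
    exact ((h₀.trans h₁).trans h₂).mono (by omega)
  · refine ⟨⟨s₁.col, s₁.q, false⟩, Or.inr ⟨by rw [Accepts, ← hq]; exact ha, rfl, ?_⟩⟩
    have h₂ : P.Within (P.headConf .decide s₁ L out pos)
      (P.headConf (.rew (Fin.last _)) ⟨s₁.col, s₁.q, false⟩ L out pos) 1 :=
        Within.step (by simp [code, ha])
    exact ((h₀.trans h₁).trans h₂).mono (by omega)

theorem update_apply_comp {ι α β : Type*} [DecidableEq ι] (f : α → β) (pos : ι → α) (d : ι)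
    (x : α) : (fun i => f (Function.update pos d x i)) =
      Function.update (fun i => f (pos i)) d (f x) := by
  funext i
  by_cases h : i = d
  · subst h; simp
  · simp [h]

theorem within_advance (s : State P.heads P.Q) (pos : Fin (P.heads + 1) → ℕ)
    (d : Fin (P.heads + 1)) (hd : pos d < L.length) :
    ∃ s' : State P.heads P.Q, (pos d + 1 = L.length → s'.ok = true) ∧
      P.Within (P.headConf (.adv d) s L out pos)
        (P.headConf (if pos d + 1 = L.length then .rew d else .sweep) s' L out
          (Function.update pos d (pos d + 1))) (n + 1) := by
  obtain ⟨s', hs, h⟩ := within_adv s [] out []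
    (fun i => (encodeCoalitions (L.take (pos i))).reverse)
    (fun i => encodeCoalitions (L.drop (pos i))) d
    ((List.finRange n).map fun p => some (decide (p ∈ L.getD (pos d) ∅))) (by simp)
    (encodeCoalitions (L.drop (pos d + 1)))
    (by rw [encodeCoalitions_drop L hd, encodeCoalition]; simp)
  have hnil : encodeCoalitions (L.drop (pos d + 1)) = [] ↔ pos d + 1 = L.length := by
    rw [encodeCoalitions_eq_nil, List.drop_eq_nil_iff]; omega
  simp only [hnil] at hs h
  refine ⟨s', hs, ?_⟩
  rw [List.length_map, List.length_finRange] at h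
  convert h using 2
  · rw [update_apply_comp fun k => (encodeCoalitions (L.take k)).reverse,
      encodeCoalitions_take L hd, encodeCoalition]
    simp
  · rw [update_apply_comp fun k => encodeCoalitions (L.drop k)]

theorem within_rewind (s : State P.heads P.Q) (pos : Fin (P.heads + 1) → ℕ)
    (d : Fin (P.heads + 1)) :
    ∃ s' : State P.heads P.Q,
      P.Within (P.headConf (.rew d) s L out pos)
        (P.headConf (if d = Fin.last _ ∧ s.ok then .found (Fin.last _) else .exit d) s' L out
          (Function.update pos d 0)) ((encodeCoalitions L).length + 1) := by
  obtain ⟨s', h⟩ := within_rew s [] out []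
    (fun i => (encodeCoalitions (L.take (pos i))).reverse)
    (fun i => encodeCoalitions (L.drop (pos i))) d
  refine ⟨s', ?_⟩
  rw [headConf, headConf, update_apply_comp fun k => (encodeCoalitions (L.take k)).reverse,
    update_apply_comp fun k => encodeCoalitions (L.drop k)]
  rw [List.reverse_reverse, ← encodeCoalitions_append, List.take_append_drop] at h
  refine h.mono ?_
  rw [List.length_reverse, length_encodeCoalitions, length_encodeCoalitions, List.length_take]
  gcongr
  exact min_le_right _ _

/-- From a given configuration the machine either finds a good tuple, or it exhausts the tuples
that agree with `pos` below level `d`, none of which is good. -/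
def Outcome (c : P.Conf) (d : Fin (P.heads + 1)) (pos : Fin (P.heads + 1) → ℕ) (t : ℕ) : Prop :=
  (∃ s' pos', P.Good L pos' ∧ (∀ i, pos' i < L.length) ∧
    P.Within c (P.headConf (.found (Fin.last _)) s' L out pos') t) ∨
  (∃ s', (∀ pos' : Fin (P.heads + 1) → ℕ, (∀ i < d, pos' i = pos i) → (∀ i, pos' i < L.length) →
    ¬ P.Good L pos') ∧ P.Within c (P.headConf (.exit d) s' L out pos) t)

variable {L out}

theorem Outcome.head {c c' : P.Conf} {d : Fin (P.heads + 1)} {pos : Fin (P.heads + 1) → ℕ}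
    {t u : ℕ} (h : P.Within c c' t) (h' : Outcome L out c' d pos u) :
    Outcome L out c d pos (t + u) := by
  obtain ⟨s', pos', h1, h2, h3⟩ | ⟨s', h1, h2⟩ := h'
  · exact Or.inl ⟨s', pos', h1, h2, h.trans h3⟩
  · exact Or.inr ⟨s', h1, h.trans h2⟩

theorem Outcome.mono {c : P.Conf} {d : Fin (P.heads + 1)} {pos : Fin (P.heads + 1) → ℕ}
    {t u : ℕ} (h' : Outcome L out c d pos t) (h : t ≤ u) : Outcome L out c d pos u := by
  obtain ⟨s', pos', h1, h2, h3⟩ | ⟨s', h1, h2⟩ := h'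
  · exact Or.inl ⟨s', pos', h1, h2, h3.mono h⟩
  · exact Or.inr ⟨s', h1, h2.mono h⟩

/-- `Good` overwrites the position of the last head, so only the other positions matter. -/
theorem good_congr {pos pos' : Fin (P.heads + 1) → ℕ}
    (h : ∀ i < Fin.last _, pos' i = pos i) (hg : P.Good L pos') : P.Good L pos := by
  intro c hc
  convert hg c hc using 2
  funext i
  by_cases hi : i = Fin.last _
  · subst hi; simp
  · rw [Function.update_of_ne hi, Function.update_of_ne hi, h i (Fin.lt_last_iff_ne_last.2 hi)]

/-- Induction on the number `k` of blocks still ahead of the universal head, all earlier ones having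
been accepted. One round costs `2 * n + 5` for the check and `n + 1` for the advance. -/
theorem outcome_last (k : ℕ) (s : State P.heads P.Q) (pos : Fin (P.heads + 1) → ℕ)
    (hpos : ∀ i, pos i < L.length) (hk : pos (Fin.last _) + k = L.length)
    (hacc : ∀ c < pos (Fin.last _), P.Accepts (tuple L (Function.update pos (Fin.last _) c))) :
    Outcome L out (P.headConf .sweep s L out pos) (Fin.last _)
      (Function.update pos (Fin.last _) 0)
      (k * (3 * n + 6) + ((encodeCoalitions L).length + 1)) := by
  induction k generalizing s pos with
  | zero => exact absurd (hpos (Fin.last _)) (by omega)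
  | succ k ih =>
    have hlen : 0 < L.length := lt_of_le_of_lt (Nat.zero_le _) (hpos 0)
    have hzero : ∀ i, Function.update pos (Fin.last _) 0 i < L.length := fun i => by
      by_cases hi : i = Fin.last _
      · subst hi; simpa using hlen
      · simpa [hi] using hpos i
    obtain ⟨s₁, ⟨ha, h₁⟩ | ⟨ha, hok, h₁⟩⟩ := within_check L out s pos hpos
    · obtain ⟨s₂, hs₂, h₂⟩ := within_advance L out s₁ pos (Fin.last _) (hpos _)
      have hacc' : ∀ c < pos (Fin.last _) + 1,
          P.Accepts (tuple L (Function.update pos (Fin.last _) c)) := by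
        intro c hc
        rcases Nat.lt_succ_iff_lt_or_eq.1 hc with hc | rfl
        · exact hacc c hc
        · rwa [Function.update_eq_self]
      by_cases he : pos (Fin.last _) + 1 = L.length
      · rw [if_pos he] at h₂
        obtain ⟨s₃, h₃⟩ := within_rewind L out s₂ (Function.update pos (Fin.last _)
          (pos (Fin.last _) + 1)) (Fin.last _)
        rw [if_pos ⟨rfl, hs₂ he⟩, Function.update_idem] at h₃
        refine Or.inl ⟨s₃, _, ?_, hzero, ((h₁.trans h₂).trans h₃).mono ?_⟩
        · intro c hc
          rw [Function.update_idem]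
          exact hacc' c (by omega)
        · rw [add_mul]; omega
      · rw [if_neg he] at h₂
        have := ih s₂ (Function.update pos (Fin.last _) (pos (Fin.last _) + 1)) ?_ ?_ ?_
        · rw [Function.update_idem] at this
          refine (Outcome.head (h₁.trans h₂) this).mono ?_
          rw [add_mul]; omega
        · intro i
          by_cases hi : i = Fin.last _
          · subst hi
            have := hpos (Fin.last _)
            rw [Function.update_self]; omega
          · simpa [hi] using hpos i
        · rw [Function.update_self]; omega
        · intro c hc
          rw [Function.update_self] at hc
          rw [Function.update_idem]
          exact hacc' c hc
    · obtain ⟨s₂, h₂⟩ := within_rewind L out s₁ pos (Fin.last _)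
      rw [if_neg (by simp [hok])] at h₂
      refine Or.inr ⟨s₂, fun pos' h hpos' hg => ha ?_, (h₁.trans h₂).mono ?_⟩
      · have := good_congr (pos := pos) (fun i hi => (h i hi).trans
          (Function.update_of_ne hi.ne _ _)) hg (pos (Fin.last _)) (hpos _)
        rwa [Function.update_eq_self] at this
      · rw [add_mul]; omega

/-- `T` bounds one run of the inner loops, which leave their heads at 0 when they fail. The
invariant `hbad` says that the positions of head `d` already passed lead to no good tuple. -/
theorem outcome_castSucc {T : ℕ} (d : Fin P.heads)
    (hT : ∀ (s : State P.heads P.Q) (pos : Fin (P.heads + 1) → ℕ), (∀ i, pos i < L.length) →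
      (∀ i, d.succ ≤ i → pos i = 0) →
      Outcome L out (P.headConf .sweep s L out pos) d.succ pos T)
    (k : ℕ) (s : State P.heads P.Q) (pos : Fin (P.heads + 1) → ℕ)
    (hpos : ∀ i, pos i < L.length) (hk : pos d.castSucc + k = L.length)
    (hzero : ∀ i, d.succ ≤ i → pos i = 0)
    (hbad : ∀ pos' : Fin (P.heads + 1) → ℕ, (∀ i < d.castSucc, pos' i = pos i) →
      pos' d.castSucc < pos d.castSucc → (∀ i, pos' i < L.length) → ¬ P.Good L pos') :
    Outcome L out (P.headConf .sweep s L out pos) d.castSucc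
      (Function.update pos d.castSucc 0)
      (k * (T + n + 2) + ((encodeCoalitions L).length + 1)) := by
  induction k generalizing s pos with
  | zero => exact absurd (hpos d.castSucc) (by omega)
  | succ k ih =>
    obtain ⟨s', pos', hg, hp, h⟩ | ⟨s₁, hno, h₁⟩ := hT s pos hpos hzero
    · exact Or.inl ⟨s', pos', hg, hp, h.mono (by rw [add_mul]; omega)⟩
    have hbad' : ∀ pos' : Fin (P.heads + 1) → ℕ, (∀ i < d.castSucc, pos' i = pos i) →
        pos' d.castSucc < pos d.castSucc + 1 → (∀ i, pos' i < L.length) → ¬ P.Good L pos' := by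
      intro pos' hi hd hl
      rcases Nat.lt_succ_iff_lt_or_eq.1 hd with hd | hd
      · exact hbad pos' hi hd hl
      · refine hno pos' (fun i hi' => ?_) hl
        rcases (Fin.le_castSucc_iff.2 hi').lt_or_eq with h | rfl
        · exact hi i h
        · exact hd
    have h₂ : P.Within (P.headConf (.exit d.succ) s₁ L out pos)
        (P.headConf (.adv d.castSucc) s₁ L out pos) 1 := Within.step (by simp [code])
    obtain ⟨s₃, -, h₃⟩ := within_advance L out s₁ pos d.castSucc (hpos _)
    by_cases he : pos d.castSucc + 1 = L.length
    · rw [if_pos he] at h₃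
      obtain ⟨s₄, h₄⟩ := within_rewind L out s₃ (Function.update pos d.castSucc
        (pos d.castSucc + 1)) d.castSucc
      rw [if_neg (fun h => (Fin.castSucc_lt_last d).ne h.1), Function.update_idem] at h₄
      refine Or.inr ⟨s₄, fun pos' h hl => hbad' pos' (fun i hi => (h i hi).trans
        (Function.update_of_ne hi.ne _ _)) (by rw [he]; exact hl _) hl, ?_⟩
      refine (((h₁.trans h₂).trans h₃).trans h₄).mono ?_
      rw [add_mul]; omega
    · rw [if_neg he] at h₃
      have := ih s₃ (Function.update pos d.castSucc (pos d.castSucc + 1)) ?_ ?_ ?_ ?_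
      · rw [Function.update_idem] at this
        refine (Outcome.head ((h₁.trans h₂).trans h₃) this).mono ?_
        rw [add_mul]; omega
      · intro i
        by_cases hi : i = d.castSucc
        · subst hi
          have := hpos d.castSucc
          rw [Function.update_self]; omega
        · simpa [hi] using hpos i
      · rw [Function.update_self]; omega
      · intro i hi
        rw [Function.update_of_ne ?_, hzero i hi]
        rintro rfl
        exact absurd hi (not_le.2 Fin.castSucc_lt_succ)
      · intro pos' hi hd hl
        rw [Function.update_self] at hd
        exact hbad' pos' (fun i hi' => (hi i hi').trans (Function.update_of_ne hi'.ne _ _)) hd hl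

end loops

/-- The time of `k` nested loops over a list of `l` blocks of length `n + 1`. -/
def loopTime (n l : ℕ) : ℕ → ℕ
  | 0 => l * (3 * n + 6) + (l * (n + 1) + 1)
  | k + 1 => l * (loopTime n l k + n + 2) + (l * (n + 1) + 1)

theorem outcome_sweep {L : List (Finset (Fin n))} {out : List P.O} (d : Fin (P.heads + 1))
    (s : State P.heads P.Q) (pos : Fin (P.heads + 1) → ℕ) (hpos : ∀ i, pos i < L.length)
    (hzero : ∀ i, d ≤ i → pos i = 0) :
    Outcome L out (P.headConf .sweep s L out pos) d pos
      (loopTime n L.length (P.heads - d)) := by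
  induction d using Fin.reverseInduction generalizing s pos with
  | last =>
    have h0 := hzero (Fin.last _) le_rfl
    have := outcome_last (L := L) (out := out) L.length s pos hpos (by omega)
      (fun c hc => absurd hc (by omega))
    rw [← h0, Function.update_eq_self, length_encodeCoalitions] at this
    simpa [loopTime] using this
  | cast d ih =>
    have h0 := hzero d.castSucc le_rfl
    have := outcome_castSucc (L := L) (out := out) d ih L.length s pos hpos (by omega)
      (fun i hi => hzero i (Fin.castSucc_lt_succ.le.trans hi))
      (fun pos' _ h => absurd h (by omega))
    rw [← h0, Function.update_eq_self, length_encodeCoalitions] at this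
    have e : P.heads - (d.castSucc : ℕ) = P.heads - (d.succ : ℕ) + 1 := by
      have := d.isLt
      simp only [Fin.val_castSucc, Fin.val_succ]
      omega
    rw [e]
    exact this

/-! ### Output, complete runs and polynomial time bounds -/

/-- The output of a successful search. -/
def answer (P : BlockSearch) (h : Fin (P.heads + 1) → Finset (Fin n)) : List P.O :=
  P.yes :: (List.finRange P.rounds).flatMap fun r => (columns h).map (P.write r)

/-- Induction on the rounds still to be written; those from `r` on already lie on the output stack.
-/
theorem within_found (L : List (Finset (Fin n))) (pos : Fin (P.heads + 1) → ℕ)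
    (hpos : ∀ i, pos i < L.length) (r : Fin (P.rounds + 1)) (s : State P.heads P.Q) :
    ∃ s' : State P.heads P.Q,
      P.Within (P.headConf (.found r) s L (((List.finRange P.rounds).drop r).flatMap fun r =>
          (columns (tuple L pos)).map (P.write r)) pos)
        (P.headConf .clean s' L (P.answer (tuple L pos)) pos) (r * (2 * n + 4) + 1) := by
  induction r using Fin.induction generalizing s with
  | zero =>
    refine ⟨s, Within.head ?_⟩
    simpa [code, answer] using Within.refl _
  | succ r ih =>
    set o := ((List.finRange P.rounds).drop r.succ).flatMap fun r =>
      (columns (tuple L pos)).map (P.write r) with ho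
    obtain ⟨s₁, -, -, h₁⟩ := within_scan L o (.emit r) s pos hpos
    have h₀ : P.Within (P.headConf (.found r.succ) s L o pos)
      (P.headConf (.fwd (.emit r)) s L o pos) 1 := Within.step (by simp [code])
    obtain ⟨s₂, h₂⟩ := ih s₁
    have e : ((List.finRange P.rounds).drop r.castSucc).flatMap (fun r =>
        (columns (tuple L pos)).map (P.write r)) =
        P.written (.emit r) (columns (tuple L pos)) ++ o := by
      rw [Fin.val_castSucc, List.drop_eq_getElem_cons (by simp), List.flatMap_cons, ho]
      simp [written]
    rw [e] at h₂
    refine ⟨s₂, ((h₀.trans h₁).trans h₂).mono ?_⟩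
    simp only [Fin.val_succ, Fin.val_castSucc, add_mul]
    omega

/-- The halting configuration. -/
abbrev haltConf (P : BlockSearch) (out : List P.O) : P.Conf :=
  ⟨none, P.initState, P.tape [] out [] (fun _ => []) (fun _ => [])⟩

theorem within_clean_headConf (L : List (Finset (Fin n))) (out : List P.O)
    (pos : Fin (P.heads + 1) → ℕ) (s : State P.heads P.Q) :
    P.Within (P.headConf .clean s L out pos) (P.haltConf out)
      ((encodeCoalitions L).length + 1) := by
  refine within_clean out _ _ _ rfl fun k hk => ?_
  cases k with
  | inp => simp
  | out => exact absurd rfl hk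
  | buf => simp
  | lft i =>
    rw [tape_lft, List.length_reverse, length_encodeCoalitions, length_encodeCoalitions,
      List.length_take]
    gcongr
    exact min_le_right _ _
  | rgt i =>
    rw [tape_rgt, length_encodeCoalitions, length_encodeCoalitions, List.length_drop]
    gcongr
    exact Nat.sub_le _ _

theorem within_init (L : List (Finset (Fin n))) :
    ∃ s : State P.heads P.Q,
      P.Within (P.conf .drop P.initState (encodeCoalitions (Finset.univ :: L)) [] []
        (fun _ => []) (fun _ => [])) (P.headConf .sweep s L [] fun _ => 0)
        (n + 1 + 2 * ((encodeCoalitions L).length + 1)) := by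
  obtain ⟨s₁, h₁⟩ := within_drop P.initState (encodeCoalitions L) [] [] (fun _ => [])
    (fun _ => []) ((List.finRange n).map fun p => some (decide (p ∈ Finset.univ))) (by simp)
  obtain ⟨s₂, h₂⟩ := within_load s₁ (encodeCoalitions L) [] [] (fun _ => []) (fun _ => [])
  obtain ⟨s₃, -, -, h₃⟩ := within_back s₂ [] [] (fun _ => []) (fun _ => []) .init
    ((encodeCoalitions L).reverse.map fun x _ => x)
  rw [List.append_nil] at h₂
  refine ⟨s₃, ?_⟩
  have e : encodeCoalitions (Finset.univ :: L) = ((List.finRange n).map fun p =>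
      some (decide (p ∈ Finset.univ))) ++ none :: encodeCoalitions L := by
    simp [encodeCoalitions_cons, encodeCoalition]
  rw [e]
  convert ((h₁.trans h₂).trans h₃).mono ?_ using 2
  · rfl
  · rfl
  · funext i
    rfl
  · funext i
    simp [Function.comp_def]
  · simp only [List.length_map, List.length_finRange, List.length_reverse]
    omega

/-- The time bound of the machine. -/
def totalTime (P : BlockSearch) (n l : ℕ) : ℕ :=
  loopTime n l P.heads + P.rounds * (2 * n + 4) + 3 * (l * (n + 1)) + n + 10

theorem search_outcome (P : BlockSearch) (L : List (Finset (Fin n))) (hL : L ≠ []) :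
    (∃ pos, P.Good L pos ∧ (∀ i, pos i < L.length) ∧
      P.Within (P.conf .drop P.initState (encodeCoalitions (Finset.univ :: L)) [] []
        (fun _ => []) (fun _ => [])) (P.haltConf (P.answer (tuple L pos)))
        (P.totalTime n L.length)) ∨
    ((∀ pos : Fin (P.heads + 1) → ℕ, (∀ i, pos i < L.length) → ¬ P.Good L pos) ∧
      P.Within (P.conf .drop P.initState (encodeCoalitions (Finset.univ :: L)) [] []
        (fun _ => []) (fun _ => [])) (P.haltConf [P.no]) (P.totalTime n L.length)) := by
  obtain ⟨s₀, h₀⟩ := within_init (P := P) L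
  have hlen : 0 < L.length := List.length_pos_iff.2 hL
  obtain ⟨s₁, pos, hg, hpos, h₁⟩ | ⟨s₁, hno, h₁⟩ :=
    outcome_sweep (L := L) (out := []) 0 s₀ (fun _ => 0) (fun _ => hlen) (fun _ _ => rfl)
  · obtain ⟨s₂, h₂⟩ := within_found L pos hpos (Fin.last _) s₁
    have e : (List.finRange P.rounds).drop (Fin.last P.rounds : Fin (P.rounds + 1)) = [] := by
      simp
    rw [e, List.flatMap_nil] at h₂
    refine Or.inl ⟨pos, hg, hpos,
      (((h₀.trans h₁).trans h₂).trans (within_clean_headConf _ _ _ _)).mono ?_⟩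
    rw [length_encodeCoalitions, totalTime, Fin.val_zero, Nat.sub_zero, Fin.val_last]
    omega
  · have h₂ : P.Within (P.headConf (.exit 0) s₁ L [] fun _ => 0)
        (P.headConf .clean s₁ L [P.no] fun _ => 0) 1 := Within.step (by simp [code])
    refine Or.inr ⟨fun pos => hno pos (fun i hi => absurd hi (Fin.not_lt_zero i)),
      (((h₀.trans h₁).trans h₂).trans (within_clean_headConf _ _ _ _)).mono ?_⟩
    rw [length_encodeCoalitions, totalTime, Fin.val_zero, Nat.sub_zero]
    omega

open Polynomial in
/-- A polynomial that bounds `loopTime`. -/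
noncomputable def loopPoly : ℕ → Polynomial ℕ
  | 0 => X * (3 * X + 6) + (X + 1)
  | k + 1 => X * (loopPoly k + X + 2) + (X + 1)

theorem loopTime_le {n l N : ℕ} (hn : n ≤ N) (hl : l ≤ N) (hln : l * (n + 1) ≤ N) (k : ℕ) :
    loopTime n l k ≤ (loopPoly k).eval N := by
  induction k with
  | zero => simp only [loopTime, loopPoly, Polynomial.eval_add, Polynomial.eval_mul,
      Polynomial.eval_X, Polynomial.eval_ofNat, Polynomial.eval_one]; gcongr
  | succ k ih => simp only [loopTime, loopPoly, Polynomial.eval_add, Polynomial.eval_mul,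
      Polynomial.eval_X, Polynomial.eval_ofNat, Polynomial.eval_one]; gcongr

open Polynomial in
/-- A polynomial that bounds the running time of the machine in terms of the input length. -/
noncomputable def totalPoly (P : BlockSearch) : Polynomial ℕ :=
  loopPoly P.heads + (P.rounds : Polynomial ℕ) * (2 * X + 4) + 3 * X + X + 10

theorem totalTime_le (P : BlockSearch) {n l N : ℕ} (hn : n ≤ N) (hl : l ≤ N)
    (hln : l * (n + 1) ≤ N) : P.totalTime n l ≤ P.totalPoly.eval N := by
  simp only [totalTime, totalPoly, Polynomial.eval_add, Polynomial.eval_mul,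
      Polynomial.eval_X, Polynomial.eval_ofNat, Polynomial.eval_natCast, Nat.cast_id]
  gcongr
  exact loopTime_le hn hl hln _

theorem initList_machine (l : List (Option Bool)) :
    initList P.machine l = P.conf .drop P.initState l [] [] (fun _ => []) (fun _ => []) := by
  simp only [initList, conf]
  congr 1
  funext k
  cases k <;> rfl

theorem haltList_machine (l : List P.O) : haltList P.machine l = P.haltConf l := by
  simp only [haltList, haltConf]
  congr 1
  funext k
  cases k <;> rfl

/-- A function whose values are computed by the machine on all inputs is computable in polynomial
time. -/
theorem nonempty_computableInPolyTime (P : BlockSearch) {β : Type} (enc : β → List P.O)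
    (f : LosingForm → β) (hf : ∀ x : LosingForm,
      P.Within (P.conf .drop P.initState (encodeLosingForm x) [] [] (fun _ => []) (fun _ => []))
        (P.haltConf (enc (f x))) (P.totalTime x.n x.losing.length)) :
    Nonempty (TM2ComputableInPolyTime encodeLosingForm enc f) := by
  choose k hk hstep using hf
  refine ⟨⟨⟨P.machine, Equiv.refl _, Equiv.refl _⟩, P.totalPoly, fun x => ⟨⟨k x, ?_⟩, ?_⟩⟩⟩
  · have e₁ : (encodeLosingForm x).map (Equiv.refl (Option Bool)).invFun = encodeLosingForm x :=
      List.map_id _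
    have e₂ : (enc (f x)).map (Equiv.refl P.O).invFun = enc (f x) := List.map_id _
    have := hstep x
    rw [← initList_machine, ← haltList_machine, ← e₁, ← e₂] at this
    exact this
  · refine (hk x).trans ?_
    have e : (encodeLosingForm x).length = (x.losing.length + 1) * (x.n + 1) := by
      rw [encodeLosingForm, length_encodeCoalitions, List.length_cons]
    rw [e]
    -- The input has length `(l + 1) * (n + 1)`, the block for `N` included, which dominates `n`,
    -- `l` and `l * (n + 1)`.
    refine P.totalTime_le ?_ ?_ ?_ <;> nlinarith

end BlockSearch

/-! ### Trades in terms of losing coalitions -/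

section trades

/-- A set of the cardinality of `X` that contains `Y`, if `Y` is not larger than `X`. -/
noncomputable def fillUp {j : ℕ} (X Y : Finset (Fin j)) : Finset (Fin j) :=
  if h : Y.card ≤ X.card then
    (Finset.exists_subsuperset_card_eq (Finset.subset_univ Y) h X.card_le_univ).choose
  else ∅

theorem subset_fillUp {j : ℕ} {X Y : Finset (Fin j)} (h : Y.card ≤ X.card) : Y ⊆ fillUp X Y := by
  rw [fillUp, dif_pos h]
  exact (Finset.exists_subsuperset_card_eq (Finset.subset_univ Y) h X.card_le_univ).choose_spec.1

theorem card_fillUp {j : ℕ} {X Y : Finset (Fin j)} (h : Y.card ≤ X.card) :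
    (fillUp X Y).card = X.card := by
  rw [fillUp, dif_pos h]
  exact (Finset.exists_subsuperset_card_eq (Finset.subset_univ Y) h
    X.card_le_univ).choose_spec.2.2

variable {n j : ℕ}

/-- The losing coalitions `lo i`, followed by supersets of the winning coalitions `w i` that contain
every player as often as the losing coalitions do. -/
noncomputable def tradeOf (lo w : Fin j → Finset (Fin n)) (r : Fin (2 * j)) : Finset (Fin n) :=
  if (finProdFinEquiv.symm r).1 = 0 then lo (finProdFinEquiv.symm r).2 else
    Finset.univ.filter fun p => (finProdFinEquiv.symm r).2 ∈
      fillUp (Finset.univ.filter fun i => p ∈ lo i) (Finset.univ.filter fun i => p ∈ w i)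

/-- For each player, `fillUp` enlarges the set of indices of winning coalitions containing it to the
size of the losing one. Coalitions only grow, so they stay winning, and the counts become equal. -/
theorem SimpleGame.isTradeApplication_tradeOf (G : SimpleGame n) (lo w : Fin j → Finset (Fin n))
    (hlo : ∀ i, lo i ∉ G.winning) (hw : ∀ i, w i ∈ G.winning)
    (hcard : ∀ p, (Finset.univ.filter fun i => p ∈ w i).card ≤
      (Finset.univ.filter fun i => p ∈ lo i).card) :
    G.IsTradeApplication j (tradeOf lo w) := by
  have h0 (i : Fin j) : tradeOf lo w (finProdFinEquiv (0, i)) = lo i := by simp [tradeOf]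
  have h1 (i : Fin j) (p : Fin n) : p ∈ tradeOf lo w (finProdFinEquiv (1, i)) ↔
      i ∈ fillUp (Finset.univ.filter fun i => p ∈ lo i)
        (Finset.univ.filter fun i => p ∈ w i) := by simp [tradeOf]
  have hwin (i : Fin j) : tradeOf lo w (finProdFinEquiv (1, i)) ∈ G.winning := by
    refine G.mono _ _ (hw i) fun p hp => ?_
    rw [h1]
    exact subset_fillUp (hcard p) (by simpa using hp)
  obtain ⟨e, he⟩ : ∃ e : Fin 2 → Fin j ↪ Fin (2 * j), ∀ k i, e k i = finProdFinEquiv (k, i) :=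
    ⟨fun k => ⟨fun i => finProdFinEquiv (k, i), fun a b h => by simpa using h⟩, fun _ _ => rfl⟩
  have hmem (r : Fin (2 * j)) (k : Fin 2) : r ∈ Finset.univ.map (e k) ↔
      (finProdFinEquiv.symm r).1 = k := by
    obtain ⟨⟨a, i⟩, rfl⟩ := finProdFinEquiv.surjective r
    simp [he, eq_comm]
  have hcompl : (Finset.univ.map (e 1))ᶜ = Finset.univ.map (e 0) := by
    ext r
    rw [Finset.mem_compl, hmem, hmem]
    omega
  refine ⟨Finset.univ.map (e 1), by simp, fun r => ?_, fun p => ?_⟩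
  · rw [hmem]
    obtain ⟨⟨a, i⟩, rfl⟩ := finProdFinEquiv.surjective r
    rw [Equiv.symm_apply_apply]
    fin_cases a
    · simpa [h0] using hlo i
    · simpa using hwin i
  · rw [hcompl, Finset.filter_map, Finset.filter_map, Finset.card_map, Finset.card_map]
    simp only [Function.comp_def, he, h0, h1]
    rw [← card_fillUp (hcard p)]
    congr 1
    ext i
    simp

/-- A winning coalition without winning singletons contains the union of two losing coalitions that
is winning. -/
theorem SimpleGame.exists_union_mem_winning (G : SimpleGame n) {W : Finset (Fin n)}
    (hW : W ∈ G.winning) (hs : ∀ p ∈ W, {p} ∉ G.winning) :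
    ∃ A B, A ∉ G.winning ∧ B ∉ G.winning ∧ A ∪ B ∈ G.winning ∧ A ∪ B ⊆ W := by
  -- A minimal winning `w` becomes losing when any player is erased; two distinct erasures have
  -- union `w`.
  obtain ⟨w, hwW, hw⟩ := exists_minimal_le_of_wellFoundedLT (fun w => w ∈ G.winning) W hW
  have hmin (p : Fin n) (hp : p ∈ w) : w.erase p ∉ G.winning := fun h =>
    (Finset.erase_ssubset hp).not_subset (hw.2 h (Finset.erase_subset p w))
  obtain ⟨p, hp⟩ : w.Nonempty := Finset.nonempty_iff_ne_empty.2 fun h =>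
    G.empty_notMem (h ▸ hw.1)
  obtain ⟨q, hq, hqp⟩ : ∃ q ∈ w, q ≠ p := by
    by_contra! h
    exact hs p (hwW hp) (Finset.eq_singleton_iff_unique_mem.2 ⟨hp, h⟩ ▸ hw.1)
  have hu : w.erase p ∪ w.erase q = w := by
    ext x
    by_cases hx : x = p
    · subst hx; simp [hp, hqp.symm]
    · simp [hx]
  exact ⟨_, _, hmin p hp, hmin q hq, by rw [hu]; exact hw.1, by rw [hu]; exact hwW⟩

/-- Replacing the winning members by smaller winning unions can only lower the counts of players,
hence `≤` in place of equality. -/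
theorem SimpleGame.IsTrade.exists_losing {G : SimpleGame n} (h : G.IsTrade j) :
    ∃ lo A B : Fin j → Finset (Fin n), (∀ i, lo i ∉ G.winning) ∧ (∀ i, A i ∉ G.winning) ∧
      (∀ i, B i ∉ G.winning) ∧ (∀ i, A i ∪ B i ∈ G.winning) ∧
      ∀ p, (Finset.univ.filter fun i => p ∈ A i ∪ B i).card ≤
        (Finset.univ.filter fun i => p ∈ lo i).card := by
  obtain ⟨S, I, hI, hwin, hcard⟩ := h
  have hI' : Iᶜ.card = j := by rw [Finset.card_compl, hI, Fintype.card_fin]; omega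
  have key (J : Finset (Fin (2 * j))) (e : Fin j ≃ J) (p : Fin n) :
      (Finset.univ.filter fun i => p ∈ S (e i)).card = (J.filter fun r => p ∈ S r).card := by
    refine Finset.card_bij (fun i _ => e i) ?_ ?_ ?_
    · intro i hi
      simpa using hi
    · intro a _ b _ hab
      exact e.injective (Subtype.ext hab)
    · intro r hr
      rw [Finset.mem_filter] at hr
      exact ⟨e.symm ⟨r, hr.1⟩, by simpa using hr.2, by simp⟩
  let eI := (I.equivFinOfCardEq hI).symm
  let eC := (Iᶜ.equivFinOfCardEq hI').symm
  have hW (i : Fin j) : S (eI i) ∈ G.winning := (hwin _).2 (eI i).2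
  have hlo (i : Fin j) : S (eC i) ∉ G.winning := fun h =>
    Finset.mem_compl.1 (eC i).2 ((hwin _).1 h)
  have hcard' (p : Fin n) : (Finset.univ.filter fun i => p ∈ S (eI i)).card =
      (Finset.univ.filter fun i => p ∈ S (eC i)).card := by rw [key, key, hcard]
  -- By balance, `p` lies in some losing member, which would win if `{p}` did.
  have hs (i : Fin j) (p : Fin n) (hp : p ∈ S (eI i)) : {p} ∉ G.winning := by
    intro h
    have : 0 < (Finset.univ.filter fun i => p ∈ S (eC i)).card := by
      rw [← hcard', Finset.card_pos]
      exact ⟨i, by simpa using hp⟩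
    obtain ⟨k, hk⟩ := Finset.card_pos.1 this
    exact hlo k (G.mono _ _ h (by simpa using hk))
  choose A B hA hB hAB hsub using fun i => G.exists_union_mem_winning (hW i) (hs i)
  refine ⟨fun i => S (eC i), A, B, hlo, hA, hB, hAB, fun p => ?_⟩
  rw [← hcard']
  exact Finset.card_le_card fun i hi => by
    rw [Finset.mem_filter] at hi ⊢
    exact ⟨hi.1, hsub i hi.2⟩

end trades

/-! ### The automaton that recognises trades -/

namespace BlockSearch

open Turing

/-- The head for the `i`-th coalition of the `k`-th kind. -/
def headOf {j : ℕ} (k : Fin 3) (i : Fin j) : Fin (3 * j + 1) := (finProdFinEquiv (k, i)).castSucc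

/-- The indices `i` for which the `i`-th losing coalition of the trade contains the player of a
column. -/
def losers {j : ℕ} (c : Fin (3 * j + 1) → Option Bool) : Finset (Fin j) :=
  {i | c (headOf 0 i) = some true}

/-- The indices `i` for which the union of the `i`-th coalitions of the last two kinds contains the
player of a column. -/
def winners {j : ℕ} (c : Fin (3 * j + 1) → Option Bool) : Finset (Fin j) :=
  {i | c (headOf 1 i) = some true ∨ c (headOf 2 i) = some true}

/-- The search for `j` triples `(L, A, B)` of losing coalitions such that the unions `A ∪ B` are
winning and contain every player at most as often as the coalitions `L` do. -/
abbrev tradeSearch (j : ℕ) (O : Type) [Fintype O] (yes no : O) (rounds : ℕ)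
    (write : Fin rounds → (Fin (3 * j + 1) → Option Bool) → O) : BlockSearch where
  heads := 3 * j
  Q := (Fin j → Bool) × Bool
  start := (fun _ => true, true)
  -- Bit `i` records whether the last head still agrees with the `i`-th union; the final bit,
  -- whether the counts have been admissible. The separator column changes neither.
  trans q c := (fun i => q.1 i && decide (c (Fin.last _) = some true ↔ i ∈ winners c),
    q.2 && decide ((winners c).card ≤ (losers c).card))
  accept q := decide (∀ i, q.1 i = false) && q.2
  O := O
  yes := yes
  no := no
  rounds := rounds
  write := write

theorem foldl_and {ι C : Type*} (f : ι → C → Bool) (g : C → Bool) (cs : List C)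
    (q : (ι → Bool) × Bool) :
    cs.foldl (fun (q : (ι → Bool) × Bool) c => (fun i => q.1 i && f i c, q.2 && g c)) q =
      (fun i => q.1 i && cs.all (f i), q.2 && cs.all g) := by
  induction cs generalizing q with
  | nil => simp
  | cons c cs ih => simp [ih, Bool.and_assoc]

variable {n j : ℕ} {O : Type} [Fintype O] {yes no : O} {rounds : ℕ}
    {write : Fin rounds → (Fin (3 * j + 1) → Option Bool) → O}

theorem accepts_tradeSearch (h : Fin (3 * j + 1) → Finset (Fin n)) :
    (tradeSearch j O yes no rounds write).Accepts h ↔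
      (∀ i, h (Fin.last _) ≠ h (headOf 1 i) ∪ h (headOf 2 i)) ∧
      ∀ p, (Finset.univ.filter fun i => p ∈ h (headOf 1 i) ∪ h (headOf 2 i)).card ≤
        (Finset.univ.filter fun i => p ∈ h (headOf 0 i)).card := by
  have e := foldl_and (ι := Fin j)
    (fun i c => decide (c (Fin.last (3 * j)) = some true ↔ i ∈ winners c))
    (fun c => decide ((winners c).card ≤ (losers c).card)) (columns h) (fun _ => true, true)
  unfold Accepts
  simp only
  rw [e]
  simp [columns, winners, losers, Finset.ext_iff, -Bool.decide_or]

/-- Differing from the block at every position of the last head is the same as not being listed.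
Nonemptiness of `L` keeps the count condition from being lost to a vacuous quantifier. -/
theorem good_tradeSearch {L : List (Finset (Fin n))} (hL : L ≠ []) (pos : Fin (3 * j + 1) → ℕ) :
    (tradeSearch j O yes no rounds write).Good L pos ↔
      (∀ i, tuple L pos (headOf 1 i) ∪ tuple L pos (headOf 2 i) ∉ L) ∧
      ∀ p, (Finset.univ.filter fun i =>
          p ∈ tuple L pos (headOf 1 i) ∪ tuple L pos (headOf 2 i)).card ≤
        (Finset.univ.filter fun i => p ∈ tuple L pos (headOf 0 i)).card := by
  have hlast (c : ℕ) : tuple L (Function.update pos (Fin.last _) c) (Fin.last _) =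
      L.getD c ∅ := by simp [tuple]
  have hhead (c : ℕ) (k : Fin 3) (i : Fin j) :
      tuple L (Function.update pos (Fin.last _) c) (headOf k i) = tuple L pos (headOf k i) := by
    rw [tuple, tuple, headOf, Function.update_of_ne (Fin.castSucc_lt_last _).ne]
  have hgood : (tradeSearch j O yes no rounds write).Good L pos ↔ ∀ c < L.length,
      (tradeSearch j O yes no rounds write).Accepts
        (tuple L (Function.update pos (Fin.last (3 * j)) c)) := Iff.rfl
  rw [hgood]
  simp only [accepts_tradeSearch, hlast, hhead]
  constructor
  · intro h
    refine ⟨fun i hi => ?_, (h 0 (List.length_pos_iff.2 hL)).2⟩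
    obtain ⟨c, hc, e⟩ := List.getElem_of_mem hi
    exact (h c hc).1 i (by rw [List.getD_eq_getElem _ _ hc, e])
  · rintro ⟨h, h'⟩ c hc
    refine ⟨fun i hi => h i ?_, h'⟩
    rw [← hi, List.getD_eq_getElem _ _ hc]
    exact List.getElem_mem hc

theorem tuple_mem {ι : Type*} {L : List (Finset (Fin n))} {pos : ι → ℕ} {i : ι}
    (h : pos i < L.length) : tuple L pos i ∈ L := by
  rw [tuple, List.getD_eq_getElem _ _ h]
  exact List.getElem_mem h

end BlockSearch

/-! ### Correctness of the two searches -/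

namespace LosingForm

open BlockSearch

variable {j : ℕ} {O : Type} [Fintype O] {yes no : O} {rounds : ℕ}
    {write : Fin rounds → (Fin (3 * j + 1) → Option Bool) → O} (x : LosingForm)

theorem losing_ne_nil : x.losing ≠ [] :=
  List.ne_nil_of_mem ((x.mem_losing ∅).2 x.game.empty_notMem)

theorem isTradeApplication_of_good {pos : Fin (3 * j + 1) → ℕ}
    (hpos : ∀ i, pos i < x.losing.length)
    (hg : (tradeSearch j O yes no rounds write).Good x.losing pos) :
    x.game.IsTradeApplication j (tradeOf (fun i => tuple x.losing pos (headOf 0 i))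
      fun i => tuple x.losing pos (headOf 1 i) ∪ tuple x.losing pos (headOf 2 i)) := by
  rw [good_tradeSearch x.losing_ne_nil] at hg
  refine x.game.isTradeApplication_tradeOf _ _
    (fun i => (x.mem_losing _).1 (tuple_mem (hpos _))) (fun i => ?_) hg.2
  have := hg.1 i
  rwa [x.mem_losing, not_not] at this

theorem not_isTrade_of_forall_not_good
    (hno : ∀ pos : Fin (3 * j + 1) → ℕ, (∀ i, pos i < x.losing.length) →
      ¬ (tradeSearch j O yes no rounds write).Good x.losing pos) : ¬ x.game.IsTrade j := by
  intro h
  obtain ⟨lo, A, B, hlo, hA, hB, hAB, hcard⟩ := h.exists_losing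
  have hex (y : Fin 3 × Fin j) : ∃ k < x.losing.length,
      x.losing.getD k ∅ = (![lo, A, B] : Fin 3 → Fin j → Finset (Fin x.n)) y.1 y.2 := by
    have : (![lo, A, B] : Fin 3 → Fin j → Finset (Fin x.n)) y.1 y.2 ∈ x.losing := by
      rw [x.mem_losing]
      obtain ⟨k, i⟩ := y
      fin_cases k
      exacts [hlo i, hA i, hB i]
    obtain ⟨k, hk, e⟩ := List.getElem_of_mem this
    exact ⟨k, hk, by rw [List.getD_eq_getElem _ _ hk, e]⟩
  choose idx hidx hget using hex
  let pos : Fin (3 * j + 1) → ℕ :=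
    Fin.snoc (α := fun _ => ℕ) (fun y => idx (finProdFinEquiv.symm y)) 0
  have ht (k : Fin 3) (i : Fin j) : tuple x.losing pos (headOf k i) =
      (![lo, A, B] : Fin 3 → Fin j → Finset (Fin x.n)) k i := by
    rw [tuple, headOf]
    simp only [pos, Fin.snoc_castSucc, Equiv.symm_apply_apply]
    exact hget (k, i)
  have h0 (i : Fin j) : tuple x.losing pos (headOf 0 i) = lo i := ht 0 i
  have h1 (i : Fin j) : tuple x.losing pos (headOf 1 i) = A i := ht 1 i
  have h2 (i : Fin j) : tuple x.losing pos (headOf 2 i) = B i := ht 2 i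
  refine hno pos (fun i => ?_) ?_
  · induction i using Fin.lastCases with
    | last => simpa [pos] using List.length_pos_iff.2 x.losing_ne_nil
    | cast i => simpa [pos] using hidx _
  · rw [good_tradeSearch x.losing_ne_nil]
    simp only [h0, h1, h2, x.mem_losing, not_not]
    exact ⟨hAB, hcard⟩

/-- The search that only reports whether there is a trade application. -/
abbrev decisionSearch (j : ℕ) : BlockSearch := tradeSearch j Bool true false 0 Fin.elim0

/-- The search that writes a trade application. -/
noncomputable abbrev applicationSearch (j : ℕ) : BlockSearch :=
  tradeSearch j (Option Bool) (some true) (some false) (2 * j) fun r c =>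
    if c (Fin.last _) = none then none else
      some (decide ((finProdFinEquiv.symm r).2 ∈
        if (finProdFinEquiv.symm r).1 = 0 then losers c else fillUp (losers c) (winners c)))

/-- Membership of a player in each coalition of `tradeOf` depends only on that player's column, as
`fillUp` sees nothing else; so `write` is a finite table. -/
theorem answer_applicationSearch {n : ℕ} (h : Fin (3 * j + 1) → Finset (Fin n)) :
    (applicationSearch j).answer h = encodeAnswer (some (tradeOf (fun i => h (headOf 0 i))
      fun i => h (headOf 1 i) ∪ h (headOf 2 i))) := by
  rw [encodeAnswer, encodeCoalitions, List.ofFn_eq_map, List.flatMap_map]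
  change _ :: List.flatMap _ (List.finRange (2 * j)) = _
  congr 2
  funext r
  rw [columns, encodeCoalition]
  change List.map (fun c : Fin (3 * j + 1) → Option Bool => _) _ = _
  simp only [applicationSearch, tradeSearch, List.map_append, List.map_map, List.map_cons,
    List.map_nil, if_true]
  congr 2
  funext p
  simp only [Function.comp_apply, reduceCtorEq, if_false, tradeOf, losers, winners]
  split_ifs <;> simp

theorem exists_decision (j : ℕ) : ∃ f : LosingForm → Bool,
    Nonempty (Turing.TM2ComputableInPolyTime encodeLosingForm Computability.encodeBool f) ∧
      ∀ x : LosingForm, f x = true ↔ x.game.IsTrade j := by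
  classical
  refine ⟨fun x => decide (x.game.IsTrade j), ?_, fun x => decide_eq_true_iff⟩
  refine nonempty_computableInPolyTime (decisionSearch j) _ _ fun x => ?_
  obtain ⟨pos, hg, hpos, h⟩ | ⟨hno, h⟩ := search_outcome (decisionSearch j) x.losing x.losing_ne_nil
  · have ht : x.game.IsTrade j := ⟨_, x.isTradeApplication_of_good hpos hg⟩
    rw [decide_eq_true ht]
    exact h
  · rw [decide_eq_false (x.not_isTrade_of_forall_not_good hno)]
    exact h

theorem exists_application (j : ℕ) :
    ∃ f : (x : LosingForm) → Option (Fin (2 * j) → Finset (Fin x.n)),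
      Nonempty (Turing.TM2ComputableInPolyTime encodeLosingForm
        (fun w : List (Option Bool) => w) (fun x => encodeAnswer (f x))) ∧
      ∀ x : LosingForm,
        (∀ S, f x = some S → x.game.IsTradeApplication j S) ∧
        (x.game.IsTrade j → (f x).isSome) := by
  have key (x : LosingForm) : ∃ o : Option (Fin (2 * j) → Finset (Fin x.n)),
      (applicationSearch j).Within ((applicationSearch j).conf .drop (applicationSearch j).initState
        (encodeLosingForm x) [] [] (fun _ => []) (fun _ => []))
        ((applicationSearch j).haltConf (encodeAnswer o))
        ((applicationSearch j).totalTime x.n x.losing.length) ∧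
      (∀ S, o = some S → x.game.IsTradeApplication j S) ∧ (x.game.IsTrade j → o.isSome) := by
    obtain ⟨pos, hg, hpos, h⟩ | ⟨hno, h⟩ :=
      search_outcome (applicationSearch j) x.losing x.losing_ne_nil
    · refine ⟨some (tradeOf (fun i => tuple x.losing pos (headOf 0 i))
        fun i => tuple x.losing pos (headOf 1 i) ∪ tuple x.losing pos (headOf 2 i)), ?_, ?_,
        fun _ => rfl⟩
      · rw [← answer_applicationSearch]
        exact h
      · rintro S ⟨⟩
        exact x.isTradeApplication_of_good hpos hg
    · exact ⟨none, h, by simp, fun ht => absurd ht (x.not_isTrade_of_forall_not_good hno)⟩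
  choose f hf hS using key
  exact ⟨f, nonempty_computableInPolyTime (applicationSearch j) _ _ hf, hS⟩

end LosingForm

/-- For every fixed `j`, given a simple game by its losing coalitions: (1) some Turing machine
decides in polynomial time whether the game is `j`-trade, and (2) some polynomial time Turing
machine outputs a `j`-trade application if the game is `j`-trade, and reports that there is none
otherwise. -/
theorem mainTheorem4 (j : ℕ) :
    (∃ f : LosingForm → Bool,
      Nonempty (Turing.TM2ComputableInPolyTime encodeLosingForm Computability.encodeBool f) ∧
      ∀ x : LosingForm, f x = true ↔ x.game.IsTrade j) ∧
    (∃ f : (x : LosingForm) → Option (Fin (2 * j) → Finset (Fin x.n)),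
      Nonempty (Turing.TM2ComputableInPolyTime encodeLosingForm
        (fun w : List (Option Bool) => w) (fun x => encodeAnswer (f x))) ∧
      ∀ x : LosingForm,
        (∀ S, f x = some S → x.game.IsTradeApplication j S) ∧
        (x.game.IsTrade j → (f x).isSome)) :=
  ⟨LosingForm.exists_decision j, LosingForm.exists_application j⟩
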